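/- Let $(\Omega,\mathcal F,\mathbb P)$ be a probability space carrying a standard real Brownian motion $B=(B_t)_{t\ge 0}$ (with $B_0=0$ and continuous paths, almost surely), and let $\mathcal F_t=\sigma(B_s : s\le t)$ be its natural filtration. Let $T\ge 0$ and let $\Psi\in C([0,T];L^2(\Omega))$ be real-valued and adapted, i.e. for every $t\in[0,T]$ the class $\Psi(t)$ has an $\mathcal F_t$-measurable representative. For a partition $\pi$: $0=t_0<t_1<\dots<t_n=T$ and $t\in[0,T]$ put $$S_\pi(t)=\sum_{i=0}^{n-1}\Psi(t_i)\bigl(B_{t_{i+1}\wedge t}-B_{t_i\wedge t}\bigr).$$ Theorem. The stochastic integral of $\Psi$ with respect to $B$ exists and is a continuous square-integrable martingale: there is a process $\bigl(\int_0^t\Psi\,dB\bigr)_{t\in[0,T]}$ with values in $L^2(\Omega)$ such that 1. for every $t\in[0,T]$ and every sequence $(\pi_k)$ of partitions of $[0,T]$ whose mesh tends to $0$, the sums $S_{\pi_k}(t)$ lie in $L^2(\Omega)$ and converge to $\int_0^t\Psi\,dB$ in $L^2(\Omega)$; 2. almost surely, $t\mapsto\int_0^t\Psi\,dB$ is continuous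 on $[0,T]$; 3. $\bigl(\int_0^t\Psi\,dB\bigr)_{t\in[0,T]}$ is a martingale with respect to $(\mathcal F_t)_{t\in[0,T]}$ (in particular adapted to it); 4. (Itô isometry) for every $t\in[0,T]$, $$\mathbb E\Bigl[\Bigl|\int_0^t\Psi\,dB\Bigr|^2\Bigr]=\int_0^t\mathbb E\bigl[\Psi(s)^2\bigr]\,ds .$$ -/

import Mathlib

open MeasureTheory ProbabilityTheory Filter Topology
open scoped NNReal ENNReal

/-- A partition `0 = t₀ < t₁ < ⋯ < tₙ = T` of the interval `[0, T]`. -/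
structure TimePartition (T : ℝ≥0) where
  /-- the number of subintervals -/
  n : ℕ
  /-- the partition points -/
  pt : Fin (n + 1) → Set.Icc (0 : ℝ≥0) T
  strictMono : StrictMono pt
  pt_zero : (pt 0 : ℝ≥0) = 0
  pt_last : (pt (Fin.last n) : ℝ≥0) = T

/-- The mesh `max_i (t_{i+1} - t_i)` of a partition. -/
noncomputable def TimePartition.mesh {T : ℝ≥0} (π : TimePartition T) : ℝ≥0 :=
  Finset.univ.sup fun i : Fin π.n => (π.pt i.succ : ℝ≥0) - (π.pt i.castSucc : ℝ≥0)

/-- The left-endpoint sum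
`∑_{i < n} Ψ(t_i) (B(t_{i+1} ∧ t) - B(t_i ∧ t))`, as a random variable. -/
noncomputable def leftRiemannSum {Ω : Type*} [MeasurableSpace Ω] {P : Measure Ω} {T : ℝ≥0}
    (B : ℝ≥0 → Ω → ℝ) (Ψ : C(Set.Icc (0 : ℝ≥0) T, Lp ℝ 2 P)) (π : TimePartition T)
    (t : ℝ≥0) (ω : Ω) : ℝ :=
  ∑ i : Fin π.n, (Ψ (π.pt i.castSucc) : Ω → ℝ) ω *
    (B (min (π.pt i.succ : ℝ≥0) t) ω - B (min (π.pt i.castSucc : ℝ≥0) t) ω)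

/-- The natural filtration `ℱ_t = σ(B_s : s ≤ t)`, `t ∈ [0, T]`. -/
def brownianFiltration {Ω : Type*} [MeasurableSpace Ω] (T : ℝ≥0) (B : ℝ≥0 → Ω → ℝ)
    (hB : ∀ t, Measurable (B t)) : Filtration (Set.Icc (0 : ℝ≥0) T) ‹MeasurableSpace Ω› :=
  Filtration.natural (fun t : Set.Icc (0 : ℝ≥0) T => B t) fun t => (hB t).stronglyMeasurable

/-- An element `Ψ` of `C([0,T]; L²(Ω))` is adapted if each class `Ψ(t)` has an `ℱ_t`-measurable
representative. -/
def IsAdaptedL2 {Ω : Type*} [MeasurableSpace Ω] {P : Measure Ω} {T : ℝ≥0}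
    (ℱ : Filtration (Set.Icc (0 : ℝ≥0) T) ‹MeasurableSpace Ω›)
    (Ψ : C(Set.Icc (0 : ℝ≥0) T, Lp ℝ 2 P)) : Prop :=
  ∀ t, AEStronglyMeasurable[ℱ t] (Ψ t : Ω → ℝ) P

/-- `I` is (a version of) the stochastic integral process `t ↦ ∫_0^t Ψ dB`, `t ∈ [0, T]`: for each
`t`, `I t` is square integrable and is the `L²` limit of the left-endpoint sums along every
sequence of partitions of `[0, T]` whose mesh tends to zero. -/
def IsStochasticIntegral {Ω : Type*} [MeasurableSpace Ω] {P : Measure Ω} {T : ℝ≥0}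
    (B : ℝ≥0 → Ω → ℝ) (Ψ : C(Set.Icc (0 : ℝ≥0) T, Lp ℝ 2 P))
    (I : Set.Icc (0 : ℝ≥0) T → Ω → ℝ) : Prop :=
  ∀ t, MemLp (I t) 2 P ∧
    ∀ π : ℕ → TimePartition T, Tendsto (fun k => (π k).mesh) atTop (𝓝 0) →
      (∀ k, MemLp (leftRiemannSum B Ψ (π k) t) 2 P) ∧
      Tendsto (fun k => eLpNorm (leftRiemannSum B Ψ (π k) t - I t) 2 P) atTop (𝓝 0)

/-! The heart is the Itô isometry for step processes. If `X` is known at time `a`, then `X` is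
independent of later increments of `B`. So two terms `X (B b - B a)` and `Y (B d - B c)` are
orthogonal over disjoint intervals, and in general have covariance equal to the length of `(a, b] ∩
(c, d]` times `E[XY]` (`integral_mul_increment_mul`). Summing gives the isometry for arbitrary,
possibly overlapping intervals. It therefore applies to the difference of sums along two partitions
with no common refinement.

By uniform continuity of `Ψ`, its left-endpoint step functions converge uniformly to it as the mesh
tends to 0, so the isometry makes the sums Cauchy in `L²`, uniformly in `t`.

For continuous paths, fix partitions whose step functions are within `4⁻ᵏ` of `Ψ`. The sums are
continuous martingales, so Doob's maximal inequality and Borel–Cantelli give almost sure uniform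
convergence in time. The integral is this pathwise limit. Fatou's lemma extends the `L²` estimate to
it and to every other sequence of partitions; the martingale property and the isometry pass to the
limit. -/

/-- The natural filtration `σ(B_s : s ≤ t)`, `t ≥ 0`, of a real process. -/
def pastFiltration {Ω : Type*} [MeasurableSpace Ω] (B : ℝ≥0 → Ω → ℝ)
    (hB : ∀ t, Measurable (B t)) : Filtration ℝ≥0 ‹MeasurableSpace Ω› :=
  Filtration.natural B fun t => (hB t).stronglyMeasurable

/-- Allows the independence arguments to run over all of `ℝ≥0`, free of the horizon `T`. -/
lemma brownianFiltration_eq_pastFiltration {Ω : Type*} [MeasurableSpace Ω] (T : ℝ≥0)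
    (B : ℝ≥0 → Ω → ℝ) (hB : ∀ t, Measurable (B t)) (t : Set.Icc (0 : ℝ≥0) T) :
    brownianFiltration T B hB t = pastFiltration B hB t := by
  apply le_antisymm
  · refine iSup₂_le fun j hj => ?_
    exact le_iSup₂_of_le (f := fun (j : ℝ≥0) (_ : j ≤ t) => MeasurableSpace.comap (B j) _)
      (j : ℝ≥0) hj le_rfl
  · refine iSup₂_le fun j hj => ?_
    exact le_iSup₂_of_le
      (f := fun (j : Set.Icc (0 : ℝ≥0) T) (_ : j ≤ t) => MeasurableSpace.comap (B j) _)
      ⟨j, zero_le, hj.trans t.2.2⟩ hj le_rfl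

lemma measurable_pastFiltration {Ω : Type*} [MeasurableSpace Ω] {B : ℝ≥0 → Ω → ℝ}
    (hB : ∀ t, Measurable (B t)) {s t : ℝ≥0} (hst : s ≤ t) :
    Measurable[pastFiltration B hB t] (B s) := by
  rw [measurable_iff_comap_le]
  exact le_iSup₂_of_le (f := fun (j : ℝ≥0) (_ : j ≤ t) => MeasurableSpace.comap (B j) _)
    s hst le_rfl

/-! ### Brownian increments and covariances of elementary integrals -/

namespace ProbabilityTheory

variable {Ω : Type*} [MeasurableSpace Ω] {P : Measure Ω} {B : ℝ≥0 → Ω → ℝ}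

lemma IsPreBrownianReal.memLp_sub (hB : IsPreBrownianReal B P) (s t : ℝ≥0) :
    MemLp (B t - B s) 2 P :=
  (hB.isGaussianProcess.hasGaussianLaw_eval t).memLp_two.sub
    (hB.isGaussianProcess.hasGaussianLaw_eval s).memLp_two

lemma IsPreBrownianReal.integral_sub_eq_zero (hB : IsPreBrownianReal B P) (s t : ℝ≥0) :
    ∫ ω, (B t - B s) ω ∂P = 0 := by
  rw [(hB.hasLaw_sub t s).integral_eq, integral_id_gaussianReal]

lemma IsPreBrownianReal.integral_sub_sq (hB : IsPreBrownianReal B P) {s t : ℝ≥0} (hst : s ≤ t) :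
    ∫ ω, (B t - B s) ω ^ 2 ∂P = t - s := by
  rw [← variance_of_integral_eq_zero (hB.memLp_sub s t).aemeasurable (hB.integral_sub_eq_zero s t),
    (hB.hasLaw_sub t s).variance_eq, variance_id_gaussianReal, coe_nndist, NNReal.val_eq_coe,
    NNReal.val_eq_coe, Real.dist_eq, abs_of_nonneg]
  exact sub_nonneg.2 (by exact_mod_cast hst)

variable {hBm : ∀ t, Measurable (B t)}

/-- Increments of Brownian motion after time `s` are independent of the past of `s`. -/
lemma IsPreBrownianReal.indepFun_past_increment (hB : IsPreBrownianReal B P) {s t : ℝ≥0}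
    (hst : s ≤ t) {X : Ω → ℝ} (hX : AEStronglyMeasurable[pastFiltration B hBm s] X P) :
    IndepFun X (B t - B s) P := by
  have h := (hB.indepFun_shift s).symm
  have h1 : IndepFun (fun ω (j : Set.Iic s) => B j ω) (B t - B s) P := by
    have hm : Measurable fun f : ℝ≥0 → ℝ => f (t - s) := by fun_prop
    have := h.comp measurable_id hm
    simpa [Function.comp_def, add_tsub_cancel_of_le hst, Pi.sub_def] using this
  -- Independence concerns generated σ-algebras, so it is proved for a representative measurable
  -- with respect to the past and then transferred to `X`.
  have h2 : IndepFun (hX.mk X) (B t - B s) P := by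
    rw [IndepFun_iff_Indep] at h1 ⊢
    refine indep_of_indep_of_le_left h1 (hX.stronglyMeasurable_mk.measurable.comap_le.trans ?_)
    refine iSup₂_le fun j hj => ?_
    rw [← measurable_iff_comap_le]
    have hj' : Measurable fun f : Set.Iic s → ℝ => f ⟨j, hj⟩ := by fun_prop
    exact hj'.comp (comap_measurable fun ω (i : Set.Iic s) => B i ω)
  exact h2.congr hX.ae_eq_mk.symm EventuallyEq.rfl

/-- A product of two `L²` variables is in general only `L¹`; here the squares are independent and
integrable, so their product is integrable. -/
lemma IsPreBrownianReal.memLp_mul_increment (hB : IsPreBrownianReal B P) {s t : ℝ≥0}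
    (hst : s ≤ t) {X : Ω → ℝ} (hX : AEStronglyMeasurable[pastFiltration B hBm s] X P)
    (hX2 : MemLp X 2 P) : MemLp (X * (B t - B s)) 2 P := by
  have hi := hB.indepFun_past_increment hst hX
  have hd := hB.memLp_sub s t
  rw [memLp_two_iff_integrable_sq (hX2.1.mul hd.1)]
  have := (hi.comp (φ := (· ^ 2)) (ψ := (· ^ 2)) (by fun_prop) (by fun_prop)).integrable_mul
    hX2.integrable_sq hd.integrable_sq
  refine this.congr (ae_of_all _ fun ω => ?_)
  simp [mul_pow]

lemma IsPreBrownianReal.integral_mul_increment (hB : IsPreBrownianReal B P) {s t : ℝ≥0}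
    (hst : s ≤ t) {X : Ω → ℝ} (hX : AEStronglyMeasurable[pastFiltration B hBm s] X P) :
    ∫ ω, X ω * (B t - B s) ω ∂P = 0 := by
  rw [(hB.indepFun_past_increment hst hX).integral_fun_mul_eq_mul_integral
    (hX.mono ((pastFiltration B hBm).le s)) (hB.memLp_sub s t).1, hB.integral_sub_eq_zero, mul_zero]

lemma IsPreBrownianReal.integral_mul_increment_sq (hB : IsPreBrownianReal B P) {s t : ℝ≥0}
    (hst : s ≤ t) {X : Ω → ℝ} (hX : AEStronglyMeasurable[pastFiltration B hBm s] X P) :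
    ∫ ω, X ω * (B t - B s) ω ^ 2 ∂P = (t - s) * ∫ ω, X ω ∂P := by
  have hi := (hB.indepFun_past_increment hst hX).comp (φ := id) (ψ := (· ^ 2))
    (by fun_prop) (by fun_prop)
  have := hi.integral_fun_mul_eq_mul_integral
    (hX.mono ((pastFiltration B hBm).le s)) (hB.memLp_sub s t).integrable_sq.1
  simp only [Function.comp_apply, id_eq] at this
  rw [this, hB.integral_sub_sq hst, mul_comm]

lemma aestronglyMeasurable_mul_increment {a b c : ℝ≥0} (hab : a ≤ b) (hbc : b ≤ c) {X : Ω → ℝ}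
    (hX : AEStronglyMeasurable[pastFiltration B hBm a] X P) :
    AEStronglyMeasurable[pastFiltration B hBm c] (X * (B b - B a)) P :=
  (hX.mono ((pastFiltration B hBm).mono (hab.trans hbc))).mul
    (((measurable_pastFiltration hBm hbc).sub
      (measurable_pastFiltration hBm (hab.trans hbc))).stronglyMeasurable.aestronglyMeasurable)

/-- Everything except the last increment is known at time `c`, and that increment is centred and
independent of the past. -/
lemma IsPreBrownianReal.integral_mul_increment_mul_of_le (hB : IsPreBrownianReal B P)
    {a b c d : ℝ≥0} (hab : a ≤ b) (hbc : b ≤ c) (hcd : c ≤ d) {X Y : Ω → ℝ}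
    (hX : AEStronglyMeasurable[pastFiltration B hBm a] X P)
    (hY : AEStronglyMeasurable[pastFiltration B hBm c] Y P) :
    ∫ ω, (X * (B b - B a)) ω * (Y * (B d - B c)) ω ∂P = 0 := by
  rw [← hB.integral_mul_increment hcd ((aestronglyMeasurable_mul_increment hab hbc hX).mul hY)]
  congr with ω
  simp only [Pi.mul_apply]
  ring

lemma IsPreBrownianReal.integral_mul_increment_mul_self (hB : IsPreBrownianReal B P)
    {a b : ℝ≥0} (hab : a ≤ b) {X Y : Ω → ℝ}
    (hX : AEStronglyMeasurable[pastFiltration B hBm a] X P)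
    (hY : AEStronglyMeasurable[pastFiltration B hBm a] Y P) :
    ∫ ω, (X * (B b - B a)) ω * (Y * (B b - B a)) ω ∂P = (b - a) * ∫ ω, X ω * Y ω ∂P := by
  have := hB.integral_mul_increment_sq hab (hX.mul hY)
  simp only [Pi.mul_apply] at this
  rw [← this]
  congr with ω
  simp only [Pi.mul_apply]
  ring

/-- Two elementary integrals starting at the same time. -/
lemma IsPreBrownianReal.integral_mul_increment_mul_of_eq_left (hB : IsPreBrownianReal B P)
    {a b d : ℝ≥0} (hab : a ≤ b) (had : a ≤ d) {X Y : Ω → ℝ}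
    (hX : AEStronglyMeasurable[pastFiltration B hBm a] X P) (hX2 : MemLp X 2 P)
    (hY : AEStronglyMeasurable[pastFiltration B hBm a] Y P) (hY2 : MemLp Y 2 P) :
    ∫ ω, (X * (B b - B a)) ω * (Y * (B d - B a)) ω ∂P =
      (min (b : ℝ) d - a) * ∫ ω, X ω * Y ω ∂P := by
  wlog hbd : b ≤ d generalizing b d X Y
  · rw [min_comm]
    simp_rw [mul_comm ((X * _) _), mul_comm (X _)]
    exact this had hab hY hY2 hX hX2 (le_of_not_ge hbd)
  have hYb := hY.mono ((pastFiltration B hBm).mono hab)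
  calc
    _ = ∫ ω, ((X * (B b - B a)) ω * (Y * (B b - B a)) ω +
        (X * (B b - B a)) ω * (Y * (B d - B b)) ω) ∂P := by
      congr with ω
      simp only [Pi.mul_apply, Pi.sub_apply]
      ring
    _ = _ := by
      rw [integral_add, hB.integral_mul_increment_mul_self hab hX hY,
        hB.integral_mul_increment_mul_of_le hab le_rfl hbd hX hYb, add_zero,
        min_eq_left (by exact_mod_cast hbd)]
      · exact (hB.memLp_mul_increment hab hX hX2).integrable_mul
          (hB.memLp_mul_increment hab hY hY2)
      · exact (hB.memLp_mul_increment hab hX hX2).integrable_mul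
          (hB.memLp_mul_increment hbd hYb hY2)

/-- Covariance of two elementary integrals. -/
lemma IsPreBrownianReal.integral_mul_increment_mul (hB : IsPreBrownianReal B P)
    {a b c d : ℝ≥0} (hab : a ≤ b) (hcd : c ≤ d) {X Y : Ω → ℝ}
    (hX : AEStronglyMeasurable[pastFiltration B hBm a] X P) (hX2 : MemLp X 2 P)
    (hY : AEStronglyMeasurable[pastFiltration B hBm c] Y P) (hY2 : MemLp Y 2 P) :
    ∫ ω, (X * (B b - B a)) ω * (Y * (B d - B c)) ω ∂P =
      max (min (b : ℝ) d - max (a : ℝ) c) 0 * ∫ ω, X ω * Y ω ∂P := by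
  wlog hac : a ≤ c generalizing a b c d X Y
  · rw [min_comm, max_comm (a : ℝ)]
    simp_rw [mul_comm ((X * _) _), mul_comm (X _)]
    exact this hcd hab hY hY2 hX hX2 (le_of_not_ge hac)
  have hac' : (a : ℝ) ≤ c := by exact_mod_cast hac
  have hcd' : (c : ℝ) ≤ d := by exact_mod_cast hcd
  rw [max_eq_right hac']
  obtain hbc | hcb := le_total b c
  · have hbc' : (b : ℝ) ≤ c := by exact_mod_cast hbc
    rw [hB.integral_mul_increment_mul_of_le hab hbc hcd hX hY, max_eq_right, zero_mul]
    linarith [min_le_left (b : ℝ) d]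
  -- Split the first increment at `c`: the part over `(a, c]` is orthogonal to the second factor,
  -- and the part over `(c, b]` starts at the same time as it.
  · have hcb' : (c : ℝ) ≤ b := by exact_mod_cast hcb
    have hXc := hX.mono ((pastFiltration B hBm).mono hac)
    calc
      _ = ∫ ω, ((X * (B c - B a)) ω * (Y * (B d - B c)) ω +
          (X * (B b - B c)) ω * (Y * (B d - B c)) ω) ∂P := by
        congr with ω
        simp only [Pi.mul_apply, Pi.sub_apply]
        ring
      _ = _ := by
        rw [integral_add, hB.integral_mul_increment_mul_of_le hac le_rfl hcd hX hY, zero_add,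
          hB.integral_mul_increment_mul_of_eq_left hcb hcd hXc hX2 hY hY2,
          max_eq_left (sub_nonneg.2 (le_min hcb' hcd'))]
        · exact (hB.memLp_mul_increment hac hX hX2).integrable_mul
            (hB.memLp_mul_increment hcd hY hY2)
        · exact (hB.memLp_mul_increment hcb hXc hX2).integrable_mul
            (hB.memLp_mul_increment hcd hY hY2)

omit [MeasurableSpace Ω] in
lemma min_sub_min_eq_zero {a b t : ℝ≥0} (hab : a ≤ b) (h : t ≤ a) :
    B (min b t) - B (min a t) = 0 := by
  rw [min_eq_right h, min_eq_right (h.trans hab), sub_self]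

lemma IsPreBrownianReal.memLp_mul_stopped_increment (hB : IsPreBrownianReal B P)
    {a b : ℝ≥0} (hab : a ≤ b) (t : ℝ≥0) {X : Ω → ℝ}
    (hX : AEStronglyMeasurable[pastFiltration B hBm a] X P) (hX2 : MemLp X 2 P) :
    MemLp (X * (B (min b t) - B (min a t))) 2 P := by
  obtain h | h := le_total t a
  · rw [min_sub_min_eq_zero hab h, mul_zero]
    exact MemLp.zero
  · rw [min_eq_left h]
    exact hB.memLp_mul_increment (le_min hab h) hX hX2

/-- Covariance of two elementary integrals stopped at a deterministic time. -/
lemma IsPreBrownianReal.integral_mul_stopped_increment_mul (hB : IsPreBrownianReal B P)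
    {a b c d : ℝ≥0} (hab : a ≤ b) (hcd : c ≤ d) (t : ℝ≥0) {X Y : Ω → ℝ}
    (hX : AEStronglyMeasurable[pastFiltration B hBm a] X P) (hX2 : MemLp X 2 P)
    (hY : AEStronglyMeasurable[pastFiltration B hBm c] Y P) (hY2 : MemLp Y 2 P) :
    ∫ ω, (X * (B (min b t) - B (min a t))) ω * (Y * (B (min d t) - B (min c t))) ω ∂P =
      max (min (min (b : ℝ) d) t - max (a : ℝ) c) 0 * ∫ ω, X ω * Y ω ∂P := by
  obtain h | h := le_total t a
  · have h' : (t : ℝ) ≤ a := by exact_mod_cast h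
    rw [min_sub_min_eq_zero hab h, max_eq_right]
    · simp
    · linarith [min_le_right (min (b : ℝ) d) t, le_max_left (a : ℝ) c]
  obtain h2 | h2 := le_total t c
  · have h' : (t : ℝ) ≤ c := by exact_mod_cast h2
    rw [min_sub_min_eq_zero hcd h2, max_eq_right]
    · simp
    · linarith [min_le_right (min (b : ℝ) d) t, le_max_right (a : ℝ) c]
  rw [min_eq_left h, min_eq_left h2, hB.integral_mul_increment_mul (le_min hab h)
    (le_min hcd h2) hX hX2 hY hY2, NNReal.coe_min, NNReal.coe_min, ← inf_inf_distrib_right]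

end ProbabilityTheory

/-! ### Step processes and their Itô isometry -/

/-- The integral up to time `t` of the step process `∑ₖ 1_{(aₖ, bₖ]} Xₖ`. -/
noncomputable def elementaryIntegral {Ω κ : Type*} [Fintype κ] (B : ℝ≥0 → Ω → ℝ)
    (a b : κ → ℝ≥0) (X : κ → Ω → ℝ) (t : ℝ≥0) (ω : Ω) : ℝ :=
  ∑ k, X k ω * (B (min (b k) t) ω - B (min (a k) t) ω)

/-- The step function `∑ₖ 1_{(aₖ, bₖ]} xₖ`. -/
noncomputable def stepFunction {κ E : Type*} [Fintype κ] [AddCommMonoid E]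
    (a b : κ → ℝ≥0) (x : κ → E) (s : ℝ) : E :=
  ∑ k, (Set.Ioc (a k : ℝ) (b k)).indicator (fun _ => x k) s

lemma stronglyMeasurable_stepFunction {κ E : Type*} [Fintype κ] [NormedAddCommGroup E]
    (a b : κ → ℝ≥0) (x : κ → E) : StronglyMeasurable (stepFunction a b x) :=
  Finset.stronglyMeasurable_fun_sum _ fun _ _ =>
    stronglyMeasurable_const.indicator measurableSet_Ioc

lemma elementaryIntegral_eq_sum {Ω κ : Type*} [Fintype κ] (B : ℝ≥0 → Ω → ℝ)
    (a b : κ → ℝ≥0) (X : κ → Ω → ℝ) (t : ℝ≥0) :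
    elementaryIntegral B a b X t = ∑ k, X k * (B (min (b k) t) - B (min (a k) t)) := by
  ext ω
  simp [elementaryIntegral]

/-- Expanding the square leaves lengths of intersections of intervals, exactly the coefficients in
`integral_mul_stopped_increment_mul`; the isometry then becomes a term-by-term comparison. -/
lemma setIntegral_norm_stepFunction_sq {κ E : Type*} [Fintype κ] [NormedAddCommGroup E]
    [InnerProductSpace ℝ E] (a b : κ → ℝ≥0) (x : κ → E) (t : ℝ≥0) :
    ∫ s in Set.Ioc (0 : ℝ) t, ‖stepFunction a b x s‖ ^ 2 =
      ∑ k, ∑ l, max (min (min (b k : ℝ) (b l)) t - max (a k : ℝ) (a l)) 0 * inner ℝ (x k) (x l) := by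
  have h (s : ℝ) : ‖stepFunction a b x s‖ ^ 2 = ∑ k, ∑ l,
      (Set.Ioc (a k : ℝ) (b k) ∩ Set.Ioc (a l : ℝ) (b l)).indicator
        (fun _ => inner ℝ (x k) (x l)) s := by
    rw [← real_inner_self_eq_norm_sq, stepFunction, sum_inner]
    refine Finset.sum_congr rfl fun k _ => ?_
    rw [inner_sum]
    refine Finset.sum_congr rfl fun l _ => ?_
    by_cases h1 : s ∈ Set.Ioc (a k : ℝ) (b k) <;> by_cases h2 : s ∈ Set.Ioc (a l : ℝ) (b l) <;>
      simp only [Set.indicator, Set.mem_inter_iff, h1, h2, if_true, if_false, inner_zero_left,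
        inner_zero_right, and_true, and_false]
  have hint (k l : κ) : Integrable ((Set.Ioc (a k : ℝ) (b k) ∩ Set.Ioc (a l : ℝ) (b l)).indicator
        (fun _ => inner ℝ (x k) (x l))) (volume.restrict (Set.Ioc (0 : ℝ) t)) :=
    (integrable_const _).indicator (measurableSet_Ioc.inter measurableSet_Ioc)
  simp_rw [h]
  rw [integral_finsetSum _ fun k _ => integrable_finsetSum _ fun l _ => hint k l]
  refine Finset.sum_congr rfl fun k _ => ?_
  rw [integral_finsetSum _ fun l _ => hint k l]
  refine Finset.sum_congr rfl fun l _ => ?_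
  rw [integral_indicator_const _ (measurableSet_Ioc.inter measurableSet_Ioc),
    measureReal_restrict_apply (measurableSet_Ioc.inter measurableSet_Ioc), Set.Ioc_inter_Ioc,
    Set.Ioc_inter_Ioc, Real.volume_real_Ioc, smul_eq_mul]
  congr 3
  exact max_eq_left (le_max_of_le_left (a k).2)

namespace ProbabilityTheory

variable {Ω : Type*} [MeasurableSpace Ω] {P : Measure Ω}
  {B : ℝ≥0 → Ω → ℝ} {hBm : ∀ t, Measurable (B t)} {κ : Type*} [Fintype κ]

lemma IsPreBrownianReal.memLp_elementaryIntegral (hB : IsPreBrownianReal B P) {a b : κ → ℝ≥0}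
    (hab : ∀ k, a k ≤ b k) {X : κ → Lp ℝ 2 P}
    (hX : ∀ k, AEStronglyMeasurable[pastFiltration B hBm (a k)] (X k) P) (t : ℝ≥0) :
    MemLp (elementaryIntegral B a b (fun k => X k) t) 2 P := by
  rw [elementaryIntegral_eq_sum]
  exact memLp_finsetSum' _ fun k _ =>
    hB.memLp_mul_stopped_increment (hab k) t (hX k) (Lp.memLp (X k))

/-- Itô isometry for step processes. -/
lemma IsPreBrownianReal.integral_elementaryIntegral_sq (hB : IsPreBrownianReal B P)
    {a b : κ → ℝ≥0} (hab : ∀ k, a k ≤ b k) {X : κ → Lp ℝ 2 P}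
    (hX : ∀ k, AEStronglyMeasurable[pastFiltration B hBm (a k)] (X k) P) (t : ℝ≥0) :
    ∫ ω, elementaryIntegral B a b (fun k => X k) t ω ^ 2 ∂P =
      ∫ s in Set.Ioc (0 : ℝ) t, ‖stepFunction a b X s‖ ^ 2 := by
  have hm (k : κ) := hB.memLp_mul_stopped_increment (hab k) t (hX k) (Lp.memLp (X k))
  have hint (k l : κ) : Integrable (fun ω =>
      ((X k : Ω → ℝ) * (B (min (b k) t) - B (min (a k) t))) ω *
        ((X l : Ω → ℝ) * (B (min (b l) t) - B (min (a l) t))) ω) P := (hm k).integrable_mul (hm l)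
  have h (ω : Ω) : elementaryIntegral B a b (fun k => X k) t ω ^ 2 = ∑ k, ∑ l,
      ((X k : Ω → ℝ) * (B (min (b k) t) - B (min (a k) t))) ω *
        ((X l : Ω → ℝ) * (B (min (b l) t) - B (min (a l) t))) ω := by
    rw [sq, elementaryIntegral, Finset.sum_mul_sum]
    rfl
  simp_rw [h]
  rw [setIntegral_norm_stepFunction_sq,
    integral_finsetSum _ fun k _ => integrable_finsetSum _ fun l _ => hint k l]
  refine Finset.sum_congr rfl fun k _ => ?_
  rw [integral_finsetSum _ fun l _ => hint k l]
  refine Finset.sum_congr rfl fun l _ => ?_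
  rw [hB.integral_mul_stopped_increment_mul (hab k) (hab l) t (hX k) (Lp.memLp (X k)) (hX l)
    (Lp.memLp (X l)), L2.inner_def]
  congr with ω
  simp [mul_comm]

/-- Itô isometry for the difference of two step processes. -/
lemma IsPreBrownianReal.integral_elementaryIntegral_sub_sq (hB : IsPreBrownianReal B P)
    {ι : Type*} [Fintype ι] {a b : κ → ℝ≥0} (hab : ∀ k, a k ≤ b k) {X : κ → Lp ℝ 2 P}
    (hX : ∀ k, AEStronglyMeasurable[pastFiltration B hBm (a k)] (X k) P)
    {c d : ι → ℝ≥0} (hcd : ∀ k, c k ≤ d k) {Y : ι → Lp ℝ 2 P}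
    (hY : ∀ k, AEStronglyMeasurable[pastFiltration B hBm (c k)] (Y k) P) (t : ℝ≥0) :
    ∫ ω, (elementaryIntegral B a b (fun k => X k) t ω -
        elementaryIntegral B c d (fun k => Y k) t ω) ^ 2 ∂P =
      ∫ s in Set.Ioc (0 : ℝ) t, ‖stepFunction a b X s - stepFunction c d Y s‖ ^ 2 := by
  -- The difference is itself one step process, indexed by the disjoint union `κ ⊕ ι` with values
  -- `X` and `-Y`. The intervals of the two families may overlap.
  have h := hB.integral_elementaryIntegral_sq (hBm := hBm) (a := Sum.elim a c) (b := Sum.elim b d)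
    (X := Sum.elim X (fun k => -Y k)) (by rintro (k | k) <;> simp [hab, hcd]) (by
      rintro (k | k)
      · exact hX k
      · exact (hY k).neg.congr (Lp.coeFn_neg (Y k)).symm) t
  convert h using 1
  · refine integral_congr_ae ?_
    have : ∀ᵐ ω ∂P, ∀ k, (-Y k : Lp ℝ 2 P) ω = -(Y k ω) := ae_all_iff.2 fun k => Lp.coeFn_neg (Y k)
    filter_upwards [this] with ω hω
    simp only [elementaryIntegral, Fintype.sum_sum_type, Sum.elim_inl, Sum.elim_inr, hω, neg_mul,
      Finset.sum_neg_distrib, ← sub_eq_add_neg]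
  · congr with s
    congr 2
    simp only [stepFunction, Fintype.sum_sum_type, Sum.elim_inl, Sum.elim_inr, sub_eq_add_neg,
      ← Finset.sum_neg_distrib]
    congr 1
    refine Finset.sum_congr rfl fun k _ => ?_
    by_cases hs : s ∈ Set.Ioc (c k : ℝ) (d k) <;>
      simp only [Set.indicator, hs, if_true, if_false, neg_zero]

end ProbabilityTheory

/-! ### Partitions and uniform approximation by step functions -/

namespace TimePartition

variable {T : ℝ≥0}

lemma pt_castSucc_le (π : TimePartition T) (i : Fin π.n) :
    (π.pt i.castSucc : ℝ≥0) ≤ π.pt i.succ :=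
  π.strictMono.monotone i.castSucc_lt_succ.le

lemma sub_le_mesh (π : TimePartition T) (i : Fin π.n) :
    (π.pt i.succ : ℝ≥0) - π.pt i.castSucc ≤ π.mesh :=
  Finset.le_sup (f := fun i : Fin π.n => (π.pt i.succ : ℝ≥0) - (π.pt i.castSucc : ℝ≥0))
    (Finset.mem_univ i)

lemma exists_mem_Ioc (π : TimePartition T) {s : ℝ} (hs : s ∈ Set.Ioc (0 : ℝ) T) :
    ∃ i : Fin π.n, s ∈ Set.Ioc (((π.pt i.castSucc : ℝ≥0) : ℝ)) ((π.pt i.succ : ℝ≥0) : ℝ) := by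
  -- Take the first partition point at or beyond `s`; it is not `t₀` because `s > 0`, so it has a
  -- predecessor, which lies strictly before `s`.
  obtain ⟨j, hj, hmin⟩ := WellFounded.has_min (wellFounded_lt (α := Fin (π.n + 1)))
    {j | s ≤ ((π.pt j : ℝ≥0) : ℝ)} ⟨Fin.last _, by simpa [π.pt_last] using hs.2⟩
  obtain rfl | ⟨i, rfl⟩ := Fin.eq_zero_or_eq_succ j
  · simp only [Set.mem_ofPred_eq, π.pt_zero, NNReal.coe_zero] at hj
    exact absurd hs.1 (not_lt.2 hj)
  · refine ⟨i, ?_, hj⟩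
    by_contra h
    exact hmin i.castSucc (not_lt.1 h) i.castSucc_lt_succ

/-- The left-endpoint step function of `x` along `π`. -/
noncomputable def step {E : Type*} [AddCommMonoid E] (π : TimePartition T)
    (x : Set.Icc (0 : ℝ≥0) T → E) : ℝ → E :=
  stepFunction (fun i : Fin π.n => (π.pt i.castSucc : ℝ≥0)) (fun i => (π.pt i.succ : ℝ≥0))
    (fun i => x (π.pt i.castSucc))

lemma step_eq_of_mem {E : Type*} [AddCommMonoid E] (π : TimePartition T)
    (x : Set.Icc (0 : ℝ≥0) T → E) {s : ℝ} {i : Fin π.n}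
    (hi : s ∈ Set.Ioc (((π.pt i.castSucc : ℝ≥0) : ℝ)) ((π.pt i.succ : ℝ≥0) : ℝ)) :
    π.step x s = x (π.pt i.castSucc) := by
  rw [step, stepFunction, Finset.sum_eq_single i, Set.indicator_of_mem hi]
  · intro j _ hji
    apply Set.indicator_of_notMem
    intro hj
    rcases lt_or_gt_of_ne hji with h | h
    · have : (π.pt j.succ : ℝ≥0) ≤ π.pt i.castSucc :=
        π.strictMono.monotone (Fin.succ_le_castSucc_iff.2 h)
      exact absurd (hj.2.trans (NNReal.coe_le_coe.2 this)) (not_le.2 hi.1)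
    · have : (π.pt i.succ : ℝ≥0) ≤ π.pt j.castSucc :=
        π.strictMono.monotone (Fin.succ_le_castSucc_iff.2 h)
      exact absurd (hi.2.trans (NNReal.coe_le_coe.2 this)) (not_le.2 hj.1)
  · simp

/-- The extension to `ℝ` of a function on `[0, T]`. -/
noncomputable def extend {E : Type*} (x : Set.Icc (0 : ℝ≥0) T → E) (s : ℝ) : E :=
  x (Set.projIcc 0 T (zero_le : (0 : ℝ≥0) ≤ T) s.toNNReal)

/-- The left-endpoint step functions of a continuous function converge uniformly to it as the mesh
tends to zero. -/
lemma exists_norm_step_sub_le {E : Type*} [NormedAddCommGroup E] (x : C(Set.Icc (0 : ℝ≥0) T, E))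
    {ε : ℝ} (hε : 0 < ε) : ∃ δ : ℝ≥0, 0 < δ ∧ ∀ π : TimePartition T, π.mesh < δ →
      ∀ s ∈ Set.Ioc (0 : ℝ) T, ‖π.step x s - extend x s‖ ≤ ε := by
  have hu := CompactSpace.uniformContinuous_of_continuous x.continuous
  obtain ⟨δ, hδ, h⟩ := Metric.uniformContinuous_iff.1 hu ε hε
  lift δ to ℝ≥0 using hδ.le
  refine ⟨δ, by exact_mod_cast hδ, fun π hπ s hs => ?_⟩
  obtain ⟨i, hi⟩ := π.exists_mem_Ioc hs
  rw [step_eq_of_mem π x hi, extend, ← dist_eq_norm]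
  refine (h ?_).le
  have hs' : s.toNNReal ∈ Set.Icc (0 : ℝ≥0) T := ⟨zero_le, Real.toNNReal_le_iff_le_coe.2 hs.2⟩
  rw [Set.projIcc_of_mem _ hs', Subtype.dist_eq, NNReal.dist_eq, Real.coe_toNNReal _ hs.1.le,
    abs_of_nonpos (sub_nonpos.2 hi.1.le)]
  have h1 := (π.sub_le_mesh i).trans_lt hπ
  rw [← NNReal.coe_lt_coe, NNReal.coe_sub (π.pt_castSucc_le i)] at h1
  linarith [hi.2]

lemma norm_step_le {E : Type*} [NormedAddCommGroup E] (x : C(Set.Icc (0 : ℝ≥0) T, E))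
    (π : TimePartition T) {s : ℝ} (hs : s ∈ Set.Ioc (0 : ℝ) T) : ‖π.step x s‖ ≤ ‖x‖ := by
  obtain ⟨i, hi⟩ := π.exists_mem_Ioc hs
  rw [step_eq_of_mem π x hi]
  exact x.norm_coe_le_norm _

/-- There are partitions of arbitrarily small mesh. -/
lemma exists_mesh_lt (T : ℝ≥0) {δ : ℝ≥0} (hδ : 0 < δ) : ∃ π : TimePartition T, π.mesh < δ := by
  obtain rfl | hT := eq_or_ne T 0
  · exact ⟨⟨0, fun _ => ⟨0, by simp⟩, @Subsingleton.strictMono (Fin 1) _ _ _ _ _, rfl, rfl⟩, by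
      simpa [mesh] using hδ⟩
  obtain ⟨n, hn⟩ := exists_nat_gt (T / δ)
  have hT' : 0 < T := pos_iff_ne_zero.2 hT
  have hn0 : (0 : ℝ≥0) < n := (zero_le).trans_lt hn
  refine ⟨⟨n, fun i => ⟨i * (T / n), zero_le, ?_⟩, ?_, by simp, ?_⟩, ?_⟩
  · calc (i : ℝ≥0) * (T / n) ≤ n * (T / n) := by
          gcongr
          exact_mod_cast Nat.lt_succ_iff.1 i.2
      _ = T := mul_div_cancel₀ _ hn0.ne'
  · intro i j hij
    rw [← Subtype.coe_lt_coe]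
    have h : (0 : ℝ≥0) < T / n := div_pos hT' hn0
    have hij' : (i : ℝ≥0) < j := by exact_mod_cast hij
    exact mul_lt_mul_of_pos_right hij' h
  · simpa using mul_div_cancel₀ T hn0.ne'
  · rw [mesh, Finset.sup_lt_iff (by exact hδ)]
    intro i _
    simp only [Fin.val_succ, Fin.val_castSucc, Nat.cast_add, Nat.cast_one, add_mul, one_mul,
      add_tsub_cancel_left]
    rwa [div_lt_comm₀ hn0 hδ]

end TimePartition

/-! ### `L²` estimates for left-endpoint sums -/

lemma MeasureTheory.MemLp.eLpNorm_two_eq_sqrt_integral_sq {Ω : Type*} [MeasurableSpace Ω]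
    {μ : Measure Ω} {f : Ω → ℝ} (hf : MemLp f 2 μ) :
    eLpNorm f 2 μ = ENNReal.ofReal √(∫ ω, f ω ^ 2 ∂μ) := by
  rw [hf.eLpNorm_eq_integral_rpow_norm (by norm_num) (by norm_num), Real.sqrt_eq_rpow]
  simp

section

variable {Ω : Type*} [MeasurableSpace Ω] {P : Measure Ω}
  {B : ℝ≥0 → Ω → ℝ} {hBm : ∀ t, Measurable (B t)} {T : ℝ≥0}
  {Ψ : C(Set.Icc (0 : ℝ≥0) T, Lp ℝ 2 P)}

lemma IsAdaptedL2.aestronglyMeasurable (hΨ : IsAdaptedL2 (brownianFiltration T B hBm) Ψ)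
    (t : Set.Icc (0 : ℝ≥0) T) : AEStronglyMeasurable[pastFiltration B hBm t] (Ψ t : Ω → ℝ) P := by
  rw [← brownianFiltration_eq_pastFiltration T B hBm t]
  exact hΨ t

lemma memLp_leftRiemannSum (hB : IsPreBrownianReal B P)
    (hΨ : IsAdaptedL2 (brownianFiltration T B hBm) Ψ) (π : TimePartition T) (t : ℝ≥0) :
    MemLp (leftRiemannSum B Ψ π t) 2 P :=
  hB.memLp_elementaryIntegral (X := fun i => Ψ (π.pt i.castSucc)) π.pt_castSucc_le
    (fun _ => hΨ.aestronglyMeasurable _) t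

lemma integral_leftRiemannSum_sq (hB : IsPreBrownianReal B P)
    (hΨ : IsAdaptedL2 (brownianFiltration T B hBm) Ψ) (π : TimePartition T) (t : ℝ≥0) :
    ∫ ω, leftRiemannSum B Ψ π t ω ^ 2 ∂P = ∫ s in Set.Ioc (0 : ℝ) t, ‖π.step Ψ s‖ ^ 2 :=
  hB.integral_elementaryIntegral_sq (X := fun i => Ψ (π.pt i.castSucc)) π.pt_castSucc_le
    (fun _ => hΨ.aestronglyMeasurable _) t

/-- By the isometry, this is the `L²` distance of two step functions on `(0, t]`. Both are within
`ε` of `Ψ`, hence within `2ε` of each other, on an interval of length at most `T`. -/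
lemma eLpNorm_leftRiemannSum_sub_le (hB : IsPreBrownianReal B P)
    (hΨ : IsAdaptedL2 (brownianFiltration T B hBm) Ψ) {π ρ : TimePartition T} {ε : ℝ} (hε : 0 ≤ ε)
    (hπ : ∀ s ∈ Set.Ioc (0 : ℝ) T, ‖π.step Ψ s - TimePartition.extend Ψ s‖ ≤ ε)
    (hρ : ∀ s ∈ Set.Ioc (0 : ℝ) T, ‖ρ.step Ψ s - TimePartition.extend Ψ s‖ ≤ ε)
    {t : ℝ≥0} (ht : t ≤ T) :
    eLpNorm (leftRiemannSum B Ψ π t - leftRiemannSum B Ψ ρ t) 2 P ≤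
      ENNReal.ofReal (√T * (2 * ε)) := by
  have hm := (memLp_leftRiemannSum hB hΨ π t).sub (memLp_leftRiemannSum hB hΨ ρ t)
  rw [hm.eLpNorm_two_eq_sqrt_integral_sq]
  refine ENNReal.ofReal_le_ofReal ?_
  refine Real.sqrt_le_iff.2 ⟨by positivity, ?_⟩
  rw [mul_pow, Real.sq_sqrt T.coe_nonneg]
  calc
    _ = ∫ s in Set.Ioc (0 : ℝ) t, ‖π.step Ψ s - ρ.step Ψ s‖ ^ 2 :=
      hB.integral_elementaryIntegral_sub_sq (X := fun i => Ψ (π.pt i.castSucc))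
        (Y := fun i => Ψ (ρ.pt i.castSucc)) π.pt_castSucc_le
        (fun _ => hΨ.aestronglyMeasurable _) ρ.pt_castSucc_le
        (fun _ => hΨ.aestronglyMeasurable _) t
    _ ≤ (2 * ε) ^ 2 * volume.real (Set.Ioc (0 : ℝ) t) := by
      refine (Real.le_norm_self _).trans
        (norm_setIntegral_le_of_norm_le_const measure_Ioc_lt_top fun s hs => ?_)
      have hs' : s ∈ Set.Ioc (0 : ℝ) T := ⟨hs.1, hs.2.trans (NNReal.coe_le_coe.2 ht)⟩
      rw [norm_pow, norm_norm]
      gcongr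
      have := norm_sub_le (π.step Ψ s - TimePartition.extend Ψ s)
        (ρ.step Ψ s - TimePartition.extend Ψ s)
      rw [sub_sub_sub_cancel_right] at this
      linarith [hπ s hs', hρ s hs']
    _ ≤ T * (2 * ε) ^ 2 := by
      rw [Real.volume_real_Ioc, sub_zero, max_eq_left t.coe_nonneg, mul_comm]
      gcongr

/-- The second moments of the left-endpoint sums converge to the integral of the second moment. -/
lemma tendsto_integral_leftRiemannSum_sq (hB : IsPreBrownianReal B P)
    (hΨ : IsAdaptedL2 (brownianFiltration T B hBm) Ψ) {π : ℕ → TimePartition T} {ε : ℕ → ℝ}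
    (hε : Tendsto ε atTop (𝓝 0))
    (hπ : ∀ k, ∀ s ∈ Set.Ioc (0 : ℝ) T, ‖(π k).step Ψ s - TimePartition.extend Ψ s‖ ≤ ε k)
    {t : ℝ≥0} (ht : t ≤ T) :
    Tendsto (fun k => ∫ ω, leftRiemannSum B Ψ (π k) t ω ^ 2 ∂P) atTop
      (𝓝 (∫ s in Set.Ioc (0 : ℝ) t, ‖TimePartition.extend Ψ s‖ ^ 2)) := by
  simp_rw [integral_leftRiemannSum_sq hB hΨ]
  have hsub {s : ℝ} (hs : s ∈ Set.Ioc (0 : ℝ) t) : s ∈ Set.Ioc (0 : ℝ) T :=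
    ⟨hs.1, hs.2.trans (NNReal.coe_le_coe.2 ht)⟩
  refine tendsto_integral_of_dominated_convergence (fun _ => ‖Ψ‖ ^ 2) (fun k => ?_)
    (integrable_const _) (fun k => ?_) ?_
  · exact ((stronglyMeasurable_stepFunction _ _ _).norm.pow 2).aestronglyMeasurable
  · refine (ae_restrict_iff' measurableSet_Ioc).2 (ae_of_all _ fun s hs => ?_)
    rw [norm_pow, norm_norm]
    gcongr
    exact TimePartition.norm_step_le Ψ (π k) (hsub hs)
  · refine (ae_restrict_iff' measurableSet_Ioc).2 (ae_of_all _ fun s hs => ?_)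
    refine (Tendsto.norm ?_).pow 2
    rw [tendsto_iff_norm_sub_tendsto_zero]
    exact squeeze_zero (fun _ => norm_nonneg _) (fun k => hπ k s (hsub hs)) hε

end

/-! ### Doob's maximal inequality -/

namespace MeasureTheory

variable {Ω ι : Type*} {m0 : MeasurableSpace Ω} {μ : Measure Ω} [IsFiniteMeasure μ]
  [LinearOrder ι] {ℱ : Filtration ι m0} {M : ι → Ω → ℝ}

/-- Doob's maximal inequality for a martingale restricted to a finite set of times. -/
lemma Martingale.maximal_ineq_finset (hM : Martingale M ℱ μ) (F : Finset ι) {m : ι}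
    (hF : ∀ t ∈ F, t ≤ m) (ε : ℝ≥0) :
    ε * μ {ω | ∃ t ∈ F, (ε : ℝ) ≤ |M t ω|} ≤ eLpNorm (M m) 1 μ := by
  -- Enumerate `F` increasingly and stay at `m` afterwards. Along `u` the martingale is a discrete
  -- one, and index `F.card` is already at the terminal time.
  let u : ℕ → ι := fun j => if h : j < F.card then F.orderEmbOfFin rfl ⟨j, h⟩ else m
  have hu : Monotone u := by
    intro i j hij
    by_cases hj : j < F.card
    · have hi := hij.trans_lt hj
      simp only [u, hi, hj, dif_pos]
      exact (F.orderEmbOfFin rfl).monotone hij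
    · by_cases hi : i < F.card
      · simp only [u, hi, hj, dif_pos, dif_neg, not_false_eq_true]
        exact hF _ (F.orderEmbOfFin_mem rfl _)
      · simp only [u, hi, hj, dif_neg, not_false_eq_true, le_refl]
  have hum : u F.card = m := by simp [u]
  let 𝒢 : Filtration ℕ m0 := ⟨fun j => ℱ (u j), fun i j hij => ℱ.mono (hu hij), fun j => ℱ.le _⟩
  have hN : Martingale (fun j => M (u j)) 𝒢 μ :=
    ⟨fun j => hM.1 (u j), fun i j hij => hM.2 _ _ (hu hij)⟩
  have hsub : Submartingale (fun j ω => |M (u j) ω|) 𝒢 μ := by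
    exact hN.submartingale.sup hN.neg.submartingale
  have h := maximal_ineq hsub (fun j ω => abs_nonneg _) (ε := ε) F.card
  calc
    _ ≤ ε * μ {ω | (ε : ℝ) ≤ (Finset.range (F.card + 1)).sup' Finset.nonempty_range_add_one
          fun k => |M (u k) ω|} := by
      gcongr
      rintro ⟨t, ht, h⟩
      rw [← Finset.mem_coe, ← F.range_orderEmbOfFin rfl] at ht
      obtain ⟨i, rfl⟩ := ht
      refine (Finset.le_sup'_iff _).2 ⟨i, by simp, ?_⟩
      simpa [u] using h
    _ ≤ _ := h
    _ ≤ ENNReal.ofReal (∫ ω, |M m ω| ∂μ) := by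
      rw [hum]
      exact ENNReal.ofReal_le_ofReal
        (setIntegral_le_integral (hM.integrable m).abs (ae_of_all _ fun ω => abs_nonneg _))
    _ = _ := by
      rw [eLpNorm_one_eq_lintegral_enorm, ← ofReal_integral_norm_eq_lintegral_enorm (hM.integrable m)]
      rfl

/-- Doob's maximal inequality for a martingale restricted to a countable set of times. -/
lemma Martingale.maximal_ineq_countable (hM : Martingale M ℱ μ) {D : Set ι} (hD : D.Countable)
    {m : ι} (hDm : ∀ t ∈ D, t ≤ m) (ε : ℝ≥0) :
    ε * μ {ω | ∃ t ∈ D, (ε : ℝ) ≤ |M t ω|} ≤ eLpNorm (M m) 1 μ := by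
  have := hD.to_subtype
  have h : {ω | ∃ t ∈ D, (ε : ℝ) ≤ |M t ω|} =
      ⋃ F : Finset D, {ω | ∃ t ∈ F.map (Function.Embedding.subtype _), (ε : ℝ) ≤ |M t ω|} := by
    ext ω
    simp only [Set.mem_ofPred_eq, Set.mem_iUnion]
    constructor
    · rintro ⟨t, ht, h⟩
      exact ⟨{⟨t, ht⟩}, t, by simp, h⟩
    · rintro ⟨F, t, ht, h⟩
      obtain ⟨s, _, rfl⟩ := Finset.mem_map.1 ht
      exact ⟨s, s.2, h⟩
  rw [h, Monotone.measure_iUnion, ENNReal.mul_iSup]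
  · refine iSup_le fun F => hM.maximal_ineq_finset _ (fun t ht => ?_) ε
    obtain ⟨s, _, rfl⟩ := Finset.mem_map.1 ht
    exact hDm s s.2
  · rintro F G hFG ω ⟨t, ht, h⟩
    exact ⟨t, Finset.map_subset_map.2 hFG ht, h⟩

/-- Doob's maximal inequality for an almost surely continuous martingale. -/
lemma Martingale.maximal_ineq_of_continuous [TopologicalSpace ι] [TopologicalSpace.SeparableSpace ι]
    (hM : Martingale M ℱ μ) (hc : ∀ᵐ ω ∂μ, Continuous fun t => M t ω) {m : ι}
    (hm : ∀ t, t ≤ m) (ε : ℝ≥0) :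
    ε * μ {ω | ∃ t, (ε : ℝ) < |M t ω|} ≤ eLpNorm (M m) 1 μ := by
  obtain ⟨D, hD, hDd⟩ := TopologicalSpace.exists_countable_dense ι
  refine le_trans ?_ (hM.maximal_ineq_countable hD (fun t _ => hm t) ε)
  gcongr 1
  refine measure_mono_ae ?_
  filter_upwards [hc] with ω hω
  rintro ⟨t, ht⟩
  -- The strict inequality makes the set of exceedance times open, so a nonempty one meets the
  -- countable dense set.
  have ho : IsOpen {t | (ε : ℝ) < |M t ω|} := isOpen_lt continuous_const hω.abs
  obtain ⟨s, hs, hsD⟩ := hDd.inter_open_nonempty _ ho ⟨t, ht⟩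
  exact ⟨s, hsD, le_of_lt hs⟩

end MeasureTheory

/-! ### Martingale property of elementary integrals -/

namespace ProbabilityTheory

variable {Ω : Type*} [MeasurableSpace Ω] {P : Measure Ω}
  {B : ℝ≥0 → Ω → ℝ} {hBm : ∀ t, Measurable (B t)}

/-- Before time `a`, when `X` may not yet be known, the increment vanishes. -/
lemma stronglyMeasurable_mul_stopped_increment {a b : ℝ≥0} (hab : a ≤ b) {X : Ω → ℝ}
    (hX : StronglyMeasurable[pastFiltration B hBm a] X) (t : ℝ≥0) :
    StronglyMeasurable[pastFiltration B hBm t] (X * (B (min b t) - B (min a t))) := by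
  obtain h | h := le_total t a
  · rw [min_sub_min_eq_zero hab h, mul_zero]
    exact stronglyMeasurable_zero
  · exact (hX.mono ((pastFiltration B hBm).mono h)).mul
      ((measurable_pastFiltration hBm (min_le_right _ _)).sub
        (measurable_pastFiltration hBm (min_le_right _ _))).stronglyMeasurable

-- Writes the change of the stopped path between `s` and `t` as an increment after `s`, to which
-- independence from the past applies.
omit [MeasurableSpace Ω] in
lemma min_sub_min_eq {s t : ℝ≥0} (hst : s ≤ t) (b : ℝ≥0) :
    B (min b t) - B (min b s) = B (min (max b s) t) - B s := by
  obtain h | h := le_total b s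
  · rw [min_eq_left h, min_eq_left (h.trans hst), max_eq_right h, min_eq_left hst, sub_self,
      sub_self]
  · rw [min_eq_right h, max_eq_left h]

lemma IsPreBrownianReal.martingale_mul_stopped_increment (hB : IsPreBrownianReal B P)
    {a b : ℝ≥0} (hab : a ≤ b) {X : Ω → ℝ}
    (hX : StronglyMeasurable[pastFiltration B hBm a] X) (hX2 : MemLp X 2 P) :
    Martingale (fun t => X * (B (min b t) - B (min a t))) (pastFiltration B hBm) P := by
  have : IsProbabilityMeasure P := hB.isGaussianProcess.isProbabilityMeasure
  have hint (t : ℝ≥0) : Integrable (X * (B (min b t) - B (min a t))) P :=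
    (hB.memLp_mul_stopped_increment hab t hX.aestronglyMeasurable hX2).integrable one_le_two
  refine ⟨stronglyMeasurable_mul_stopped_increment hab hX, fun s t hst => ?_⟩
  refine (ae_eq_condExp_of_forall_setIntegral_eq ((pastFiltration B hBm).le s) (hint t)
    (fun _ _ _ => (hint s).integrableOn) (fun A hA _ => ?_)
    (stronglyMeasurable_mul_stopped_increment hab hX s).aestronglyMeasurable).symm
  symm
  rw [← sub_eq_zero, ← integral_sub (hint t).integrableOn (hint s).integrableOn]
  obtain h | h := le_total t a
  · rw [min_sub_min_eq_zero hab h, min_sub_min_eq_zero hab (hst.trans h)]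
    simp
  -- On `A`, the change from `s` to `t` is `X` times the increment of `B` from `max a s` to `min
  -- (max b s) t`. The indicator of `A` times `X` is known at `max a s`, so the integral vanishes.
  · have hle : max a s ≤ min (max b s) t :=
      le_min (max_le_max_right s hab) (max_le h hst)
    have hA' : MeasurableSet[pastFiltration B hBm (max a s)] A :=
      (pastFiltration B hBm).mono (le_max_right a s) A hA
    have hXA : StronglyMeasurable[pastFiltration B hBm (max a s)] (A.indicator X) :=
      (hX.mono ((pastFiltration B hBm).mono (le_max_left a s))).indicator hA'
    rw [← hB.integral_mul_increment hle hXA.aestronglyMeasurable,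
      ← integral_indicator ((pastFiltration B hBm).le s A hA)]
    congr with ω
    by_cases hω : ω ∈ A
    · have h1 := congr_fun (min_sub_min_eq (B := B) hst b) ω
      have h2 := congr_fun (min_sub_min_eq (B := B) hst a) ω
      rw [min_eq_left (max_le h hst)] at h2
      simp only [Pi.sub_apply] at h1 h2
      simp only [Set.indicator_of_mem hω, Pi.mul_apply, Pi.sub_apply]
      rw [← mul_sub]
      congr 1
      linarith
    · simp [hω]

lemma IsPreBrownianReal.martingale_elementaryIntegral (hB : IsPreBrownianReal B P)
    {κ : Type*} [Fintype κ] {a b : κ → ℝ≥0} (hab : ∀ k, a k ≤ b k) {X : κ → Ω → ℝ}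
    (hX : ∀ k, StronglyMeasurable[pastFiltration B hBm (a k)] (X k)) (hX2 : ∀ k, MemLp (X k) 2 P) :
    Martingale (elementaryIntegral B a b X) (pastFiltration B hBm) P := by
  have : elementaryIntegral B a b X =
      ∑ k, fun t => X k * (B (min (b k) t) - B (min (a k) t)) := by
    ext t ω
    simp [elementaryIntegral]
  rw [this]
  exact Finset.sum_induction _ (fun M => Martingale M (pastFiltration B hBm) P)
    (fun _ _ h1 h2 => h1.add h2) (martingale_zero _ _ _)
    fun k _ => hB.martingale_mul_stopped_increment (hab k) (hX k) (hX2 k)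

end ProbabilityTheory

/-! ### Almost sure uniform limits and `L¹` limits of martingales -/

/-- The geometric tail from `k` sums to `2 · 2⁻ᵏ`. This rate does not depend on `f`, which makes the
convergence uniform in time when it is applied at each `t`. -/
lemma tendsto_limUnder_of_eventually_abs_sub_le {f : ℕ → ℝ} {K : ℕ}
    (hf : ∀ k ≥ K, |f k - f (k + 1)| ≤ (1 / 2) ^ k) :
    Tendsto f atTop (𝓝 (limUnder atTop f)) ∧
      ∀ k ≥ K, |f k - limUnder atTop f| ≤ 2 * (1 / 2) ^ k := by
  have hs (n : ℕ) (hn : K ≤ n) : ∀ j, dist (f (j + n)) (f (j + 1 + n)) ≤ (1 / 2) ^ n * (1 / 2) ^ j := by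
    intro j
    rw [← pow_add, Real.dist_eq, add_right_comm, add_comm n j]
    exact hf _ (by omega)
  have hc : CauchySeq f := by
    rw [← cauchySeq_shift K]
    exact cauchySeq_of_le_geometric (1 / 2) _ (by norm_num) (hs K le_rfl)
  refine ⟨hc.tendsto_limUnder, fun k hk => ?_⟩
  have h := dist_le_of_le_geometric_of_tendsto₀ (1 / 2 : ℝ) _ (by norm_num) (hs k hk)
    ((tendsto_add_atTop_iff_nat k).2 hc.tendsto_limUnder)
  rw [zero_add, Real.dist_eq] at h
  exact h.trans_eq (by ring)

lemma continuous_limUnder_of_eventually_abs_sub_le {α : Type*} [TopologicalSpace α]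
    {f : ℕ → α → ℝ} (hc : ∀ k, Continuous (f k))
    (hf : ∀ᶠ k in atTop, ∀ t, |f k t - f (k + 1) t| ≤ (1 / 2) ^ k) :
    (∀ t, Tendsto (fun k => f k t) atTop (𝓝 (limUnder atTop fun k => f k t))) ∧
      Continuous fun t => limUnder atTop fun k => f k t := by
  obtain ⟨K, hK⟩ := eventually_atTop.1 hf
  have h t := tendsto_limUnder_of_eventually_abs_sub_le (f := fun k => f k t)
    fun k hk => hK k hk t
  refine ⟨fun t => (h t).1, ?_⟩
  have hu : TendstoUniformly f (fun t => limUnder atTop fun k => f k t) atTop := by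
    rw [Metric.tendstoUniformly_iff]
    intro ε hε
    have h0 : Tendsto (fun k : ℕ => 2 * (1 / 2 : ℝ) ^ k) atTop (𝓝 0) := by
      simpa using (tendsto_pow_atTop_nhds_zero_of_lt_one (r := (1 / 2 : ℝ))
        (by norm_num) (by norm_num)).const_mul 2
    filter_upwards [h0.eventually_lt_const hε, eventually_ge_atTop K] with k hk hkK t
    rw [dist_comm, Real.dist_eq]
    exact ((h t).2 k hkK).trans_lt hk
  exact hu.continuous (Frequently.of_forall hc)

namespace MeasureTheory

variable {Ω ι : Type*} {m0 : MeasurableSpace Ω} {μ : Measure Ω}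

/-- An `L¹` limit of martingales is a martingale. -/
lemma martingale_of_tendsto_eLpNorm_one [IsFiniteMeasure μ] [Preorder ι] {ℱ : Filtration ι m0}
    {M : ℕ → ι → Ω → ℝ} (hM : ∀ k, Martingale (M k) ℱ μ) {N : ι → Ω → ℝ} (hN : StronglyAdapted ℱ N)
    (hint : ∀ t, Integrable (N t) μ)
    (hlim : ∀ t, Tendsto (fun k => eLpNorm (M k t - N t) 1 μ) atTop (𝓝 0)) :
    Martingale N ℱ μ := by
  refine ⟨hN, fun s t hst => ?_⟩
  refine (ae_eq_condExp_of_forall_setIntegral_eq (ℱ.le s) (hint t)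
    (fun _ _ _ => (hint s).integrableOn) (fun A hA _ => ?_)
    (hN s).aestronglyMeasurable).symm
  have h (r : ι) := tendsto_setIntegral_of_L1' (N r) (hint r).1
    (Eventually.of_forall fun k => (hM k).integrable r) (hlim r) A
  refine tendsto_nhds_unique (h s) ((h t).congr fun k => ?_)
  exact ((hM k).setIntegral_eq hst hA).symm

/-- Martingales whose consecutive terminal `L¹` distances decay like `4⁻ᵏ` converge uniformly in
time, almost surely, to a continuous process. -/
lemma ae_tendsto_limUnder_of_eLpNorm_sub_le [IsFiniteMeasure μ] [LinearOrder ι]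
    [TopologicalSpace ι] [TopologicalSpace.SeparableSpace ι] {ℱ : Filtration ι m0}
    {M : ℕ → ι → Ω → ℝ} (hM : ∀ k, Martingale (M k) ℱ μ)
    (hc : ∀ k, ∀ᵐ ω ∂μ, Continuous fun t => M k t ω) {m : ι} (hm : ∀ t, t ≤ m) {C : ℝ≥0}
    (hC : ∀ k, eLpNorm (M k m - M (k + 1) m) 1 μ ≤ C * (1 / 4) ^ k) :
    ∀ᵐ ω ∂μ, (∀ t, Tendsto (fun k => M k t ω) atTop (𝓝 (limUnder atTop fun k => M k t ω))) ∧
      Continuous fun t => limUnder atTop fun k => M k t ω := by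
  -- Doob's inequality at level `2⁻ᵏ` costs a factor `2ᵏ`, which the decay `4⁻ᵏ` absorbs, leaving
  -- the summable bound `C · 2⁻ᵏ` needed for Borel–Cantelli.
  have hb (k : ℕ) : μ {ω | ∃ t, (1 / 2 : ℝ) ^ k < |M k t ω - M (k + 1) t ω|} ≤
      C * (1 / 2) ^ k := by
    have h1 : ∀ᵐ ω ∂μ, Continuous fun t => (M k - M (k + 1)) t ω := by
      filter_upwards [hc k, hc (k + 1)] with ω h h'
      exact h.sub h'
    have h2 := (((hM k).sub (hM (k + 1))).maximal_ineq_of_continuous h1 hm ((1 / 2) ^ k)).trans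
      (hC k)
    have e1 : (((1 / 2 : ℝ≥0) ^ k : ℝ≥0) : ℝ≥0∞) = 2⁻¹ ^ k := by
      rw [ENNReal.coe_pow, one_div, ENNReal.coe_inv two_ne_zero]
      rfl
    have e2 : (1 / 4 : ℝ≥0∞) ^ k = 2⁻¹ ^ k * 2⁻¹ ^ k := by
      rw [← mul_pow, ← ENNReal.mul_inv (by simp) (by simp)]
      norm_num
    have e3 : (((1 / 2 : ℝ≥0) ^ k : ℝ≥0) : ℝ) = (1 / 2 : ℝ) ^ k := by push_cast; rfl
    rw [e1, e2, mul_left_comm, e3] at h2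
    rw [one_div (2 : ℝ≥0∞)]
    exact (ENNReal.mul_le_mul_iff_right (by simp) (by simp)).1 h2
  have hsum : ∑' k, μ {ω | ∃ t, (1 / 2 : ℝ) ^ k < |M k t ω - M (k + 1) t ω|} ≠ ∞ := by
    refine ne_top_of_le_ne_top ?_ (ENNReal.tsum_le_tsum hb)
    rw [ENNReal.tsum_mul_left, ENNReal.tsum_geometric]
    refine ENNReal.mul_ne_top ENNReal.coe_ne_top ?_
    simp
  filter_upwards [ae_eventually_notMem hsum, ae_all_iff.2 hc] with ω hω hcω
  refine continuous_limUnder_of_eventually_abs_sub_le hcω ?_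
  filter_upwards [hω] with k hk t
  by_contra h
  exact hk ⟨t, not_le.1 h⟩

lemma tendsto_integral_sq_of_tendsto_eLpNorm {f : ℕ → Ω → ℝ} {g : Ω → ℝ}
    (hf : ∀ k, MemLp (f k) 2 μ) (hg : MemLp g 2 μ)
    (h : Tendsto (fun k => eLpNorm (f k - g) 2 μ) atTop (𝓝 0)) :
    Tendsto (fun k => ∫ ω, f k ω ^ 2 ∂μ) atTop (𝓝 (∫ ω, g ω ^ 2 ∂μ)) := by
  have hn {u : Ω → ℝ} (hu : MemLp u 2 μ) : ‖hu.toLp u‖ ^ 2 = ∫ ω, u ω ^ 2 ∂μ := by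
    rw [Lp.norm_toLp, hu.eLpNorm_two_eq_sqrt_integral_sq, ENNReal.toReal_ofReal (Real.sqrt_nonneg _),
      Real.sq_sqrt (integral_nonneg fun _ => sq_nonneg _)]
  simp_rw [← hn hg, ← fun k => hn (hf k)]
  exact (((Lp.tendsto_Lp_iff_tendsto_eLpNorm'' _ hf _ hg).2 h).norm).pow 2

end MeasureTheory

/-! ### Adapted versions of the left-endpoint sums -/

section

variable {Ω : Type*} [MeasurableSpace Ω] {P : Measure Ω}
  {B : ℝ≥0 → Ω → ℝ} {hBm : ∀ t, Measurable (B t)} {T : ℝ≥0}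
  {Ψ : C(Set.Icc (0 : ℝ≥0) T, Lp ℝ 2 P)}

/-- The left-endpoint sums formed with adapted representatives of the values of `Ψ`. -/
noncomputable def adaptedRiemannSum (hΨ : IsAdaptedL2 (brownianFiltration T B hBm) Ψ)
    (π : TimePartition T) : ℝ≥0 → Ω → ℝ :=
  elementaryIntegral B (fun i : Fin π.n => (π.pt i.castSucc : ℝ≥0)) (fun i => (π.pt i.succ : ℝ≥0))
    fun i => (hΨ.aestronglyMeasurable (π.pt i.castSucc)).mk

lemma adaptedRiemannSum_ae_eq (hΨ : IsAdaptedL2 (brownianFiltration T B hBm) Ψ)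
    (π : TimePartition T) (t : ℝ≥0) :
    adaptedRiemannSum hΨ π t =ᵐ[P] leftRiemannSum B Ψ π t := by
  have h : ∀ᵐ ω ∂P, ∀ i : Fin π.n, (Ψ (π.pt i.castSucc) : Ω → ℝ) ω =
      (hΨ.aestronglyMeasurable (π.pt i.castSucc)).mk _ ω :=
    ae_all_iff.2 fun i => (hΨ.aestronglyMeasurable (π.pt i.castSucc)).ae_eq_mk
  filter_upwards [h] with ω hω
  simp only [adaptedRiemannSum, elementaryIntegral, leftRiemannSum, hω]

lemma martingale_adaptedRiemannSum (hB : IsPreBrownianReal B P)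
    (hΨ : IsAdaptedL2 (brownianFiltration T B hBm) Ψ) (π : TimePartition T) :
    Martingale (fun t : Set.Icc (0 : ℝ≥0) T => adaptedRiemannSum hΨ π t)
      (brownianFiltration T B hBm) P := by
  have h : Martingale (adaptedRiemannSum hΨ π) (pastFiltration B hBm) P :=
    hB.martingale_elementaryIntegral π.pt_castSucc_le
      (fun i => (hΨ.aestronglyMeasurable (π.pt i.castSucc)).stronglyMeasurable_mk)
      fun i => (Lp.memLp (Ψ (π.pt i.castSucc))).ae_eq
        (hΨ.aestronglyMeasurable (π.pt i.castSucc)).ae_eq_mk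
  refine ⟨fun t => ?_, fun s t hst => ?_⟩
  · rw [brownianFiltration_eq_pastFiltration]
    exact h.1 t
  · rw [brownianFiltration_eq_pastFiltration]
    exact h.2 s t hst

lemma ae_continuous_adaptedRiemannSum (hB : IsBrownianReal B P)
    (hΨ : IsAdaptedL2 (brownianFiltration T B hBm) Ψ) (π : TimePartition T) :
    ∀ᵐ ω ∂P, Continuous fun t : Set.Icc (0 : ℝ≥0) T => adaptedRiemannSum hΨ π t ω := by
  filter_upwards [hB.cont] with ω hω
  have hmin (c : ℝ≥0) : Continuous fun t : Set.Icc (0 : ℝ≥0) T => B (min c t) ω :=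
    hω.comp (continuous_const.min continuous_subtype_val)
  simp only [adaptedRiemannSum, elementaryIntegral]
  fun_prop

/-- The integral of a continuous `L²`-valued function in terms of second moments. -/
lemma intervalIntegral_integral_sq_eq (t : ℝ≥0) :
    ∫ s in (0 : ℝ)..(t : ℝ), ∫ ω,
      (Ψ (Set.projIcc 0 T (zero_le : (0 : ℝ≥0) ≤ T) s.toNNReal) : Ω → ℝ) ω ^ 2 ∂P =
      ∫ s in Set.Ioc (0 : ℝ) t, ‖TimePartition.extend Ψ s‖ ^ 2 := by
  rw [intervalIntegral.integral_of_le t.coe_nonneg]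
  congr with s
  rw [← real_inner_self_eq_norm_sq, L2.inner_def]
  congr with ω
  simp [TimePartition.extend, sq]

end

/-! ### Construction of the stochastic integral -/

theorem mainTheorem3 {Ω : Type*} [MeasurableSpace Ω] (P : Measure Ω) [IsProbabilityMeasure P]
    (B : ℝ≥0 → Ω → ℝ) (hBm : ∀ t, Measurable (B t)) (hB : IsBrownianReal B P)
    (T : ℝ≥0) (Ψ : C(Set.Icc (0 : ℝ≥0) T, Lp ℝ 2 P))
    (hΨ : IsAdaptedL2 (brownianFiltration T B hBm) Ψ) :
    ∃ I : Set.Icc (0 : ℝ≥0) T → Ω → ℝ,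
      IsStochasticIntegral B Ψ I ∧
      (∀ᵐ ω ∂P, Continuous fun t => I t ω) ∧
      Martingale I (brownianFiltration T B hBm) P ∧
      ∀ t : Set.Icc (0 : ℝ≥0) T,
        ∫ ω, |I t ω| ^ 2 ∂P =
          ∫ s in (0 : ℝ)..((t : ℝ≥0) : ℝ),
            ∫ ω, (Ψ (Set.projIcc 0 T (zero_le : (0 : ℝ≥0) ≤ T) s.toNNReal) : Ω → ℝ) ω ^ 2 ∂P := by
  have hB' := hB.toIsPreBrownianReal
  have hpart (k : ℕ) : ∃ π : TimePartition T, ∀ s ∈ Set.Ioc (0 : ℝ) T,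
      ‖π.step Ψ s - TimePartition.extend Ψ s‖ ≤ (1 / 4) ^ k := by
    obtain ⟨δ, hδ, h⟩ := TimePartition.exists_norm_step_sub_le Ψ
      (ε := (1 / 4) ^ k) (by positivity)
    obtain ⟨π, hπ⟩ := TimePartition.exists_mesh_lt T hδ
    exact ⟨π, h π hπ⟩
  choose ρ hρ using hpart
  have hlim4 : Tendsto (fun k : ℕ => (1 / 4 : ℝ) ^ k) atTop (𝓝 0) :=
    tendsto_pow_atTop_nhds_zero_of_lt_one (by norm_num) (by norm_num)
  have hlim : Tendsto (fun k : ℕ => ENNReal.ofReal (√T * (2 * (1 / 4 : ℝ) ^ k))) atTop (𝓝 0) := by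
    simpa using ENNReal.tendsto_ofReal ((hlim4.const_mul 2).const_mul √T)
  -- Adapted representatives are needed because a martingale must be measurable with respect to the
  -- filtration itself, which is not completed by null sets.
  let S : ℕ → Set.Icc (0 : ℝ≥0) T → Ω → ℝ := fun k t => adaptedRiemannSum hΨ (ρ k) t
  have hSeq (k : ℕ) (t : Set.Icc (0 : ℝ≥0) T) : S k t =ᵐ[P] leftRiemannSum B Ψ (ρ k) t :=
    adaptedRiemannSum_ae_eq hΨ (ρ k) t
  have hSm (k : ℕ) : Martingale (S k) (brownianFiltration T B hBm) P :=
    martingale_adaptedRiemannSum hB' hΨ (ρ k)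
  have hS2 (k : ℕ) (t : Set.Icc (0 : ℝ≥0) T) : MemLp (S k t) 2 P :=
    (memLp_leftRiemannSum hB' hΨ (ρ k) t).ae_eq (hSeq k t).symm
  -- Where no limit exists, `limUnder` takes a fixed default value. Hence `I t` is measurable with
  -- respect to `ℱ_t` everywhere, with no null sets added.
  let I : Set.Icc (0 : ℝ≥0) T → Ω → ℝ := fun t ω => limUnder atTop fun k => S k t ω
  have hmain : ∀ᵐ ω ∂P, (∀ t, Tendsto (fun k => S k t ω) atTop (𝓝 (I t ω))) ∧
      Continuous fun t => I t ω := by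
    refine ae_tendsto_limUnder_of_eLpNorm_sub_le hSm
      (fun k => ae_continuous_adaptedRiemannSum hB hΨ (ρ k)) (m := ⟨T, zero_le, le_rfl⟩)
      (fun t => t.2.2) (C := NNReal.sqrt T * 2) fun k => ?_
    refine (eLpNorm_le_eLpNorm_of_exponent_le one_le_two
      ((hS2 k _).sub (hS2 (k + 1) _)).1).trans ?_
    rw [eLpNorm_congr_ae ((hSeq k _).sub (hSeq (k + 1) _))]
    refine (eLpNorm_leftRiemannSum_sub_le hB' hΨ (by positivity) (hρ k) (fun s hs =>
      (hρ (k + 1) s hs).trans (pow_le_pow_of_le_one (by norm_num) (by norm_num) k.le_succ))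
      le_rfl).trans_eq ?_
    rw [← mul_assoc, ENNReal.ofReal_mul (by positivity), ENNReal.ofReal_pow (by positivity),
      ENNReal.ofReal_div_of_pos (by norm_num), ← Real.coe_sqrt, ← NNReal.coe_two,
      ← NNReal.coe_mul, ENNReal.ofReal_coe_nnreal]
    simp
  have hIad : StronglyAdapted (brownianFiltration T B hBm) I := fun t =>
    @StronglyMeasurable.limUnder ℕ Ω ℝ (brownianFiltration T B hBm t) _ _ atTop _ _ _ _ fun k => (hSm k).1 t
  -- Fatou: the bound `2ε√T` holds between the sum along `π` and `S k` for all large `k`, and the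
  -- `L²` norm is lower semicontinuous under almost sure convergence.
  have hclose {ε : ℝ} (hε : 0 < ε) (t : Set.Icc (0 : ℝ≥0) T) {π : TimePartition T}
      (hπ : ∀ s ∈ Set.Ioc (0 : ℝ) T, ‖π.step Ψ s - TimePartition.extend Ψ s‖ ≤ ε) :
      eLpNorm (leftRiemannSum B Ψ π t - I t) 2 P ≤ ENNReal.ofReal (√T * (2 * ε)) := by
    have hm := memLp_leftRiemannSum hB' hΨ π t
    refine (Lp.eLpNorm_lim_le_liminf_eLpNorm (fun k => (hm.sub (hS2 k t)).1) _ ?_).trans ?_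
    · filter_upwards [hmain] with ω hω
      exact tendsto_const_nhds.sub (hω.1 t)
    · refine liminf_le_of_frequently_le' (Eventually.frequently ?_)
      filter_upwards [hlim4.eventually_le_const hε] with k hk
      rw [eLpNorm_congr_ae (EventuallyEq.rfl.sub (hSeq k t))]
      exact eLpNorm_leftRiemannSum_sub_le hB' hΨ hε.le hπ (fun s hs => (hρ k s hs).trans hk) t.2.2
  have hI2 (t : Set.Icc (0 : ℝ≥0) T) : MemLp (I t) 2 P := by
    have h0 := memLp_leftRiemannSum hB' hΨ (ρ 0) t
    have hIm : AEStronglyMeasurable (I t) P :=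
      ((hIad t).mono ((brownianFiltration T B hBm).le t)).aestronglyMeasurable
    have h1 : MemLp (leftRiemannSum B Ψ (ρ 0) t - I t) 2 P :=
      ⟨h0.1.sub hIm, (hclose one_pos t (by simpa using hρ 0)).trans_lt ENNReal.ofReal_lt_top⟩
    simpa using h0.sub h1
  have hSlim (t : Set.Icc (0 : ℝ≥0) T) :
      Tendsto (fun k => eLpNorm (leftRiemannSum B Ψ (ρ k) t - I t) 2 P) atTop (𝓝 0) :=
    tendsto_of_tendsto_of_tendsto_of_le_of_le tendsto_const_nhds hlim (fun _ => zero_le)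
      fun k => hclose (by positivity) t (hρ k)
  refine ⟨I, fun t => ⟨hI2 t, fun π hπ => ⟨fun k => memLp_leftRiemannSum hB' hΨ (π k) t, ?_⟩⟩,
    hmain.mono fun ω h => h.2, ?_, fun t => ?_⟩
  -- An arbitrary sequence of partitions needs no comparison with `ρ`: once its mesh is below `δ`,
  -- `hclose` applies directly.
  · rw [ENNReal.tendsto_nhds_zero]
    intro η hη
    obtain ⟨n, hn⟩ := (hlim.eventually_le_const hη).exists
    obtain ⟨δ, hδ, h⟩ := TimePartition.exists_norm_step_sub_le Ψ
      (ε := (1 / 4) ^ n) (by positivity)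
    filter_upwards [hπ.eventually_lt_const hδ] with k hk
    exact (hclose (by positivity) t (h (π k) hk)).trans hn
  · refine martingale_of_tendsto_eLpNorm_one hSm hIad (fun t => (hI2 t).integrable one_le_two)
      fun t => ?_
    refine tendsto_of_tendsto_of_tendsto_of_le_of_le tendsto_const_nhds (hSlim t)
      (fun _ => zero_le) fun k => ?_
    refine (eLpNorm_le_eLpNorm_of_exponent_le one_le_two ((hS2 k t).sub (hI2 t)).1).trans_eq ?_
    exact eLpNorm_congr_ae ((hSeq k t).sub EventuallyEq.rfl)
  · simp_rw [sq_abs]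
    rw [intervalIntegral_integral_sq_eq]
    -- The second moments of the sums along `ρ` have two limits: one from `L²` convergence to `I t`,
    -- one from the isometry and dominated convergence.
    exact tendsto_nhds_unique
      (tendsto_integral_sq_of_tendsto_eLpNorm (fun k => memLp_leftRiemannSum hB' hΨ (ρ k) t)
        (hI2 t) (hSlim t))
      (tendsto_integral_leftRiemannSum_sq hB' hΨ hlim4 hρ t.2.2)
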